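/- Let $d\ge 2$, $N_1,\dots,N_d\ge 1$, $N_D=\prod_{i=1}^d N_i$, and $f_{L,i},f_{H,i}\in[0,1)$ for $i=1,\dots,d$. Let $\mathbb F_i$ be the closed interval $[f_{L,i},f_{H,i}]$ if $f_{L,i}<f_{H,i}$, and $\mathbb F_i=[0,1)\setminus(f_{H,i},f_{L,i})$ otherwise. For $\boldsymbol f\in[0,1)^d$ let $\mathcal A(\boldsymbol f)\in\mathbb C^{N_1\times\cdots\times N_d}$ be the tensor with entries $\mathcal A(\boldsymbol f)(k_1,\dots,k_d)=\prod_{i=1}^d e^{\mathrm i2\pi k_if_i}$, $0\le k_i\le N_i-1$. The frequency-selective multi-dimensional atomic norm of $\mathcal X\in\mathbb C^{N_1\times\cdots\times N_d}$ is $$\|\mathcal X\|_{\mathbb A(\mathbb F)}=\inf\Big\{\sum_{\ell}|\sigma_\ell| : \mathcal X=\sum_{\ell}\sigma_\ell\,\mathcal A(\boldsymbol f_\ell)\ \text{(a finite sum)},\ \sigma_\ell\in\mathbb C,\ \boldsymbol f_\ell\in\mathbb F_1\times\cdots\times\mathbb F_d\Big\}.$$ For a tensor $\mathcal B\in\mathbb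 C^{(2N_1-1)\times\cdots\times(2N_d-1)}$ with indices $p_i\in\{-N_i+1,\dots,N_i-1\}$, let $\boldsymbol T^d(\mathcal B)\in\mathbb C^{N_D\times N_D}$ be the $d$-level block Toeplitz matrix with entries $$\boldsymbol T^d(\mathcal B)(m_1,n_1;\dots;m_d,n_d)=\mathcal B(m_1-n_1,\dots,m_d-n_d),\qquad 1\le m_i,n_i\le N_i .$$ For $i=1,\dots,d$ set $$r_{0,i}=-2\cos[\pi(f_{H,i}-f_{L,i})]\,\mathrm{sign}(f_{H,i}-f_{L,i}),\quad r_{1,i}=e^{\mathrm i\pi(f_{L,i}+f_{H,i})}\,\mathrm{sign}(f_{H,i}-f_{L,i}),\quad r_{-1,i}=\overline{r_{1,i}},$$ with $\mathrm{sign}(0)=0$, and let $\boldsymbol T^d_{g_i}(\mathcal B)$ be the square matrix of size $\prod_{j}(N_j-1)$ with entries $$\boldsymbol T^d_{g_i}(\mathcal B)(m_1,n_1;\dots;m_d,n_d)=\sum_{k=-1}^{1}r_{k,i}\,\mathcal B(m_1-n_1,\dots,m_i-n_i-k,\dots,m_d-n_d),\qquad 1\le m_j,n_j\le N_j-1 .$$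 Let $\mathcal X\in\mathbb C^{N_1\times\cdots\times N_d}$ and let $\boldsymbol x\in\mathbb C^{N_D}$ be its vectorization, ordered as the rows of $\boldsymbol T^d$. Then the minimum in the semidefinite program below is attained, and $$\|\mathcal X\|_{\mathbb A(\mathbb F)}\ \ge\ \min_{\mathcal B,\,t}\ \frac1{2N_D}\mathrm{Tr}\big(\boldsymbol T^d(\mathcal B)\big)+\frac12t\quad\text{subject to}\quad\begin{bmatrix}\boldsymbol T^d(\mathcal B)&\boldsymbol x\\ \boldsymbol x^H&t\end{bmatrix}\succeq0,\quad \boldsymbol T^d_{g_i}(\mathcal B)\succeq0\ \ (i=1,\dots,d),$$ where $\mathcal B$ ranges over $\mathbb C^{(2N_1-1)\times\cdots\times(2N_d-1)}$ and $t$ over $\mathbb R$. Moreover, if some minimizer $(\mathcal B,t)$ satisfies $\mathrm{rank}\,\boldsymbol T^d(\mathcal B)<\min_iN_i$, then $\|\mathcal X\|_{\mathbb A(\mathbb F)}$ is equal to this minimum. -/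

import Mathlib

noncomputable section

namespace FSAtomic

open scoped ComplexOrder

/-- Multi-indices `(k₁, …, k_d)` with `0 ≤ k_i < N_i`. They index the entries of `d`-way tensors and,
after vectorization, the rows and columns of `d`-level matrices. -/
abbrev MultiIdx {d : ℕ} (N : Fin d → ℕ) : Type := ∀ i, Fin (N i)

/-- Complex `N₁ × ⋯ × N_d` tensors. As a function on multi-indices, a tensor is also its own
vectorization. -/
abbrev Tensor {d : ℕ} (N : Fin d → ℕ) : Type := MultiIdx N → ℂ

/-- The lags `-(N - 1), …, -1, 0, 1, …, N - 1`. -/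
abbrev Lag (N : ℕ) : Type := {p : ℤ // |p| < (N : ℤ)}

/-- Complex `(2N₁ - 1) × ⋯ × (2N_d - 1)` tensors, indexed by lags. -/
abbrev LagTensor {d : ℕ} (N : Fin d → ℕ) : Type := (∀ i, Lag (N i)) → ℂ

/-- The complex sinusoid `s(f, N) = [1, e^{i2πf}, …, e^{i2π(N-1)f}]ᵀ`. -/
def sinusoid (f : ℝ) (N : ℕ) : Fin N → ℂ :=
  fun k => Complex.exp (Complex.I * (2 * Real.pi * (k : ℕ) * f : ℝ))

/-- The multi-dimensional sinusoid `s(f₁, N₁) ⊗ ⋯ ⊗ s(f_d, N_d)`. -/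
def atom {d : ℕ} (N : Fin d → ℕ) (f : Fin d → ℝ) : Tensor N :=
  fun k => ∏ i, sinusoid (f i) (N i) (k i)

/-- The frequency band `[f_L, f_H]`: the closed interval if `f_L < f_H`, and
`[0, 1) \ (f_H, f_L)` otherwise. -/
def band (fL fH : ℝ) : Set ℝ :=
  if fL < fH then Set.Icc fL fH else Set.Ico 0 1 \ Set.Ioo fH fL

/-- The frequency-selective atomic norm: the infimum of `∑ |σ_ℓ|` over all finite decompositions
`X = ∑ σ_ℓ A(f_ℓ)` with every `f_ℓ` in the product of the bands (the infimum is taken in the extended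
reals, so it is `⊤` if there is no decomposition). -/
def atomicNorm {d : ℕ} (N : Fin d → ℕ) (fL fH : Fin d → ℝ) (X : Tensor N) : EReal :=
  sInf {c : EReal | ∃ (r : ℕ) (f : Fin r → Fin d → ℝ) (σ : Fin r → ℂ),
    (∀ l i, f l i ∈ band (fL i) (fH i)) ∧
    X = ∑ l, σ l • atom N (f l) ∧
    c = ((∑ l, ‖σ l‖ : ℝ) : EReal)}

/-- The difference of two indices is a lag. -/
theorem abs_sub_lt {N : ℕ} (m n : Fin N) : |((m : ℕ) : ℤ) - ((n : ℕ) : ℤ)| < (N : ℤ) := by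
  have hm := m.isLt
  have hn := n.isLt
  rw [abs_lt]
  constructor <;> omega

/-- The difference of two indices in `{0, …, N - 2}`, shifted by at most one, is a lag. -/
theorem abs_sub_sub_lt {N : ℕ} (m n : Fin (N - 1)) (k : ℤ) (hk : |k| ≤ 1) :
    |((m : ℕ) : ℤ) - ((n : ℕ) : ℤ) - k| < (N : ℤ) := by
  have hm := m.isLt
  have hn := n.isLt
  rw [abs_le] at hk
  rw [abs_lt]
  constructor <;> omega

/-- The `d`-level block Toeplitz matrix `T(B)`, with entries
`T(m₁, n₁; …; m_d, n_d) = B(m₁ - n₁, …, m_d - n_d)`. -/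
def blockToeplitz {d : ℕ} {N : Fin d → ℕ} (B : LagTensor N) :
    Matrix (MultiIdx N) (MultiIdx N) ℂ :=
  fun m n => B fun i => ⟨((m i : ℕ) : ℤ) - ((n i : ℕ) : ℤ), abs_sub_lt (m i) (n i)⟩

/-- A Hermitian trigonometric polynomial of degree one,
`g(x) = r₁ x⁻¹ + r₀ + r₋₁ x` with `r₀` real and `r₋₁` the conjugate of `r₁`. -/
structure TrigPoly where
  /-- the constant coefficient -/
  r0 : ℝ
  /-- the coefficient of `x⁻¹` -/
  r1 : ℂ

/-- The coefficient `r_k` of `x^{-k}`. -/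
def TrigPoly.coeff (g : TrigPoly) (k : ℤ) : ℂ :=
  if k = 0 then (g.r0 : ℂ) else if k = 1 then g.r1
  else if k = -1 then (starRingEnd ℂ) g.r1 else 0

/-- The polynomial `g` attached to the band `[f_L, f_H]`; its values on the unit circle are
nonnegative exactly on the band. -/
def bandPoly (fL fH : ℝ) : TrigPoly where
  r0 := -2 * Real.cos (Real.pi * (fH - fL)) * Real.sign (fH - fL)
  r1 := Complex.exp (Complex.I * (Real.pi * (fL + fH) : ℝ)) * (Real.sign (fH - fL) : ℝ)

/-- The multi-lag `(m₁ - n₁, …, m_i - n_i - k, …, m_d - n_d)`, for `m_j, n_j ∈ {0, …, N_j - 2}` and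
`|k| ≤ 1`. -/
def shiftedLag {d : ℕ} {N : Fin d → ℕ} (i : Fin d) (m n : MultiIdx fun j => N j - 1)
    (k : ℤ) (hk : |k| ≤ 1) : ∀ j, Lag (N j) :=
  fun j => ⟨((m j : ℕ) : ℤ) - ((n j : ℕ) : ℤ) - (if j = i then k else 0),
    abs_sub_sub_lt (m j) (n j) _ (by split <;> simp [hk])⟩

/-- The `d`-level block Toeplitz matrix `T_g(B)` in direction `i`, of size
`∏ (N_j - 1)`, with entries `∑_{k = -1}^{1} r_k B(m₁ - n₁, …, m_i - n_i - k, …, m_d - n_d)`. -/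
def polyToeplitz {d : ℕ} {N : Fin d → ℕ} (g : TrigPoly) (i : Fin d) (B : LagTensor N) :
    Matrix (MultiIdx fun j => N j - 1) (MultiIdx fun j => N j - 1) ℂ :=
  fun m n => g.coeff (-1) * B (shiftedLag i m n (-1) (by simp)) +
    g.coeff 0 * B (shiftedLag i m n 0 (by simp)) +
    g.coeff 1 * B (shiftedLag i m n 1 (by simp))

/-- The bordered matrix `[[T, x], [xᴴ, t]]`. -/
def bordered {ι : Type} (T : Matrix ι ι ℂ) (x : ι → ℂ) (t : ℝ) :
    Matrix (ι ⊕ Unit) (ι ⊕ Unit) ℂ :=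
  Matrix.fromBlocks T (Matrix.replicateCol Unit x) (Matrix.replicateCol Unit x).conjTranspose
    (Matrix.of fun _ _ => (t : ℂ))

/-- Feasibility of `(B, t)` for the semidefinite program of `X`. -/
def Feasible {d : ℕ} {N : Fin d → ℕ} (fL fH : Fin d → ℝ) (X : Tensor N)
    (B : LagTensor N) (t : ℝ) : Prop :=
  (bordered (blockToeplitz B) X t).PosSemidef ∧
    ∀ i, (polyToeplitz (bandPoly (fL i) (fH i)) i B).PosSemidef

/-- The objective `Tr T(B) / (2 N_D) + t / 2`, with `N_D = N₁ ⋯ N_d` (the trace is real at every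
feasible point). -/
def objective {d : ℕ} {N : Fin d → ℕ} (B : LagTensor N) (t : ℝ) : ℝ :=
  1 / (2 * ((∏ i, N i : ℕ) : ℝ)) * (blockToeplitz B).trace.re + 1 / 2 * t

/-- `(B, t)` is a minimizer of the semidefinite program of `X`. -/
def IsOptimal {d : ℕ} {N : Fin d → ℕ} (fL fH : Fin d → ℝ) (X : Tensor N)
    (B : LagTensor N) (t : ℝ) : Prop :=
  Feasible fL fH X B t ∧
    ∀ (B' : LagTensor N) (t' : ℝ), Feasible fL fH X B' t' → objective B t ≤ objective B' t'

end FSAtomic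

end

/-!
The lower bound holds because a decomposition `X = ∑ σ_ℓ A(f_ℓ)` yields a feasible point: with
`σ_ℓ = |σ_ℓ| u_ℓ`, the bordered matrix of `B = ∑ |σ_ℓ| e^{i2π⟨p, f_ℓ⟩}` and `t = ∑ |σ_ℓ|` is
`∑ |σ_ℓ| y_ℓ y_ℓᴴ` for the bordered atoms `y_ℓ = (A(f_ℓ), conj u_ℓ)`, and each `T_{g_i}(B)` is
`∑ |σ_ℓ| g_i(f_{ℓ,i}) a_ℓ a_ℓᴴ`, for the atoms `a_ℓ` of side lengths `N_j - 1`, with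
`g_i ≥ 0` on the band. Its objective is `∑ |σ_ℓ|`
(`exists_feasible_of_decomposition`). Decompositions always exist, by Vandermonde matrices on a product
grid of frequencies, so the program is feasible; its sublevel sets are compact, hence the minimum is
attained (`exists_isOptimal`).

For the converse at low rank, the bordered matrix is the Gram matrix of vectors `v n` and `w`. Let `S`
be the span of the `v n`, whose dimension `r` is the rank of `T(B)`. The Toeplitz structure says that
the shift `v n ↦ v (n + e_i)` preserves inner products. As `r < N_i`, the Cayley–Hamilton theorem shows
that the `v n` with every `n_j` non-maximal already span `S` (`span_smallBox_eq_top`). So the shifts are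
commuting unitary operators on all of `S`, with a common orthonormal eigenbasis `b k` and eigenvalues
`e^{-i2πf_{k,i}}` (`exists_diagonal_shifts`), and `⟨v n, b k⟩ = A(f_k)(n) c_k`. Positivity of
`T_{g_i}(B)` becomes positivity of `g_i` of the `i`-th shift, that is `g_i(f_{k,i}) ≥ 0`, which puts
`f_k` into the bands (`exists_basis_atoms`). Expanding `X n = ⟨v n, w⟩` in this basis gives a
decomposition with coefficients `c_k ⟨b k, w⟩`, and `∑ |c_k| |⟨b k, w⟩| ≤ (B(0) + t) / 2` is the
objective (`atomicNorm_le_objective`).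
-/

noncomputable section

namespace FSAtomic

open scoped ComplexOrder

/-! ### The band polynomial -/

theorem conj_exp_I_mul (x : ℝ) :
    (starRingEnd ℂ) (Complex.exp (Complex.I * x)) = Complex.exp (-(Complex.I * x)) := by
  rw [← Complex.exp_conj]
  simp

/-- On the unit circle, the band polynomial factors as a product of two sines, whose signs are those
of `fH - f` and `f - fL`. -/
theorem bandPoly_value (fL fH f : ℝ) :
    (bandPoly fL fH).coeff (-1) * Complex.exp (Complex.I * (2 * Real.pi * f : ℝ)) +
      (bandPoly fL fH).coeff 0 +
      (bandPoly fL fH).coeff 1 * Complex.exp (-(Complex.I * (2 * Real.pi * f : ℝ))) =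
    ((4 * Real.sign (fH - fL) * (Real.sin (Real.pi * (fH - f)) * Real.sin (Real.pi * (f - fL))) :
      ℝ) : ℂ) := by
  have h1 : Complex.exp (-(Complex.I * (Real.pi * (fL + fH) : ℝ))) *
        Complex.exp (Complex.I * (2 * Real.pi * f : ℝ)) +
      Complex.exp (Complex.I * (Real.pi * (fL + fH) : ℝ)) *
        Complex.exp (-(Complex.I * (2 * Real.pi * f : ℝ))) =
      ((2 * Real.cos (Real.pi * (fL + fH) - 2 * Real.pi * f) : ℝ) : ℂ) := by
    rw [← Complex.exp_add, ← Complex.exp_add]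
    push_cast
    rw [Complex.two_cos, add_comm]
    congr 2 <;> ring
  have h2 : Real.cos (Real.pi * (fL + fH) - 2 * Real.pi * f) - Real.cos (Real.pi * (fH - fL)) =
      2 * (Real.sin (Real.pi * (fH - f)) * Real.sin (Real.pi * (f - fL))) := by
    rw [Real.cos_sub_cos,
      show (Real.pi * (fL + fH) - 2 * Real.pi * f + Real.pi * (fH - fL)) / 2 =
        Real.pi * (fH - f) by ring,
      show (Real.pi * (fL + fH) - 2 * Real.pi * f - Real.pi * (fH - fL)) / 2 =
        -(Real.pi * (f - fL)) by ring, Real.sin_neg]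
    ring
  have h3 : (4 * Real.sign (fH - fL) *
      (Real.sin (Real.pi * (fH - f)) * Real.sin (Real.pi * (f - fL)))) =
      Real.sign (fH - fL) * (2 * Real.cos (Real.pi * (fL + fH) - 2 * Real.pi * f)) +
        -2 * Real.cos (Real.pi * (fH - fL)) * Real.sign (fH - fL) := by
    linear_combination -2 * Real.sign (fH - fL) * h2
  rw [h3, Complex.ofReal_add, Complex.ofReal_mul (Real.sign _), ← h1]
  simp only [TrigPoly.coeff, bandPoly, map_mul, Complex.conj_ofReal, conj_exp_I_mul]
  norm_num
  ring

theorem sin_pi_mul_nonneg_iff {x : ℝ} (h1 : -1 < x) (h2 : x < 1) :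
    0 ≤ Real.sin (Real.pi * x) ↔ 0 ≤ x := by
  constructor
  · intro h
    by_contra! hx
    have := Real.sin_neg_of_neg_of_neg_pi_lt (x := Real.pi * x)
      (mul_neg_of_pos_of_neg Real.pi_pos hx) (by nlinarith [Real.pi_pos])
    linarith
  · intro h
    exact Real.sin_nonneg_of_nonneg_of_le_pi (by positivity) (by nlinarith [Real.pi_pos])

theorem sin_pi_mul_nonpos_iff {x : ℝ} (h1 : -1 < x) (h2 : x < 1) :
    Real.sin (Real.pi * x) ≤ 0 ↔ x ≤ 0 := by
  have := sin_pi_mul_nonneg_iff (x := -x) (by linarith) (by linarith)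
  rw [mul_neg, Real.sin_neg] at this
  constructor <;> intro h
  · have := this.1 (by linarith)
    linarith
  · have := this.2 (by linarith)
    linarith

theorem band_subset {fL fH : ℝ} (hL : fL ∈ Set.Ico (0 : ℝ) 1) (hH : fH ∈ Set.Ico (0 : ℝ) 1) :
    band fL fH ⊆ Set.Ico 0 1 := by
  intro f hf
  unfold band at hf
  split at hf
  · exact ⟨hL.1.trans hf.1, hf.2.trans_lt hH.2⟩
  · exact hf.1

/-- Within one period, the band polynomial is nonnegative exactly on the band. -/
theorem bandPoly_nonneg_iff {fL fH f : ℝ} (hL : fL ∈ Set.Ico (0 : ℝ) 1)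
    (hH : fH ∈ Set.Ico (0 : ℝ) 1) (hf : f ∈ Set.Ico (0 : ℝ) 1) :
    0 ≤ 4 * Real.sign (fH - fL) *
      (Real.sin (Real.pi * (fH - f)) * Real.sin (Real.pi * (f - fL))) ↔ f ∈ band fL fH := by
  obtain ⟨hL0, hL1⟩ := hL
  obtain ⟨hH0, hH1⟩ := hH
  obtain ⟨hf0, hf1⟩ := hf
  have p1 := sin_pi_mul_nonneg_iff (x := fH - f) (by linarith) (by linarith)
  have p2 := sin_pi_mul_nonneg_iff (x := f - fL) (by linarith) (by linarith)
  have q1 := sin_pi_mul_nonpos_iff (x := fH - f) (by linarith) (by linarith)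
  have q2 := sin_pi_mul_nonpos_iff (x := f - fL) (by linarith) (by linarith)
  unfold band
  split_ifs with h
  · rw [Real.sign_of_pos (by linarith), mul_one, mul_nonneg_iff_of_pos_left (by norm_num),
      mul_nonneg_iff, p1, p2, q1, q2, Set.mem_Icc]
    constructor
    · rintro (⟨h1, h2⟩ | ⟨h1, h2⟩) <;> constructor <;> linarith
    · rintro ⟨h1, h2⟩
      exact Or.inl ⟨by linarith, by linarith⟩
  · rcases eq_or_lt_of_le (not_lt.1 h) with h | h
    · subst h
      simp [hf0, hf1]
    · rw [Real.sign_of_neg (by linarith), mul_neg_one, neg_mul, ← mul_neg,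
        mul_nonneg_iff_of_pos_left (by norm_num), neg_nonneg, mul_nonpos_iff, p1, p2, q1, q2]
      simp only [Set.mem_sdiff, Set.mem_Ico, Set.mem_Ioo, hf0, hf1, and_self, true_and, not_and,
        not_lt]
      constructor
      · rintro (⟨h1, h2⟩ | ⟨h1, h2⟩) h3 <;> linarith
      · intro h1
        rcases le_or_gt f fH with h2 | h2
        · exact Or.inl ⟨by linarith, by linarith⟩
        · exact Or.inr ⟨by linarith, by linarith [h1 h2]⟩

/-! ### Toeplitz matrices of sinusoids -/

/-- The lag tensor of a single sinusoid: its block Toeplitz matrix is `a aᴴ`, for the atom `a` of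
frequency `f`. -/
def lagAtom {d : ℕ} (N : Fin d → ℕ) (f : Fin d → ℝ) : LagTensor N :=
  fun p => Complex.exp (Complex.I * (2 * Real.pi * ∑ i, ((p i : ℤ) : ℝ) * f i : ℝ))

theorem atom_eq_exp {d : ℕ} (N : Fin d → ℕ) (f : Fin d → ℝ) (k : MultiIdx N) :
    atom N f k = Complex.exp (Complex.I * (2 * Real.pi * ∑ i, ((k i : ℕ) : ℝ) * f i : ℝ)) := by
  unfold atom sinusoid
  rw [← Complex.exp_sum, ← Finset.mul_sum, ← Complex.ofReal_sum, Finset.mul_sum]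
  simp only [mul_assoc]

theorem blockToeplitz_lagAtom {d : ℕ} {N : Fin d → ℕ} (f : Fin d → ℝ) (m n : MultiIdx N) :
    blockToeplitz (lagAtom N f) m n = atom N f m * (starRingEnd ℂ) (atom N f n) := by
  rw [atom_eq_exp, atom_eq_exp, conj_exp_I_mul, ← Complex.exp_add]
  unfold blockToeplitz lagAtom
  congr 1
  push_cast
  simp only [sub_mul, Finset.sum_sub_distrib]
  ring

theorem lagAtom_shiftedLag {d : ℕ} {N : Fin d → ℕ} (f : Fin d → ℝ) (i : Fin d)
    (m n : MultiIdx fun j => N j - 1) (k : ℤ) (hk : |k| ≤ 1) :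
    lagAtom N f (shiftedLag i m n k hk) =
      Complex.exp (-(k * (Complex.I * (2 * Real.pi * f i : ℝ)))) *
        (atom (fun j => N j - 1) f m * (starRingEnd ℂ) (atom (fun j => N j - 1) f n)) := by
  rw [atom_eq_exp, atom_eq_exp, conj_exp_I_mul, ← Complex.exp_add, ← Complex.exp_add]
  have h : ∑ j, (((if j = i then k else 0 : ℤ) : ℝ) * f j) = k * f i := by
    simp [ite_mul]
  unfold lagAtom shiftedLag
  congr 1
  simp only [Int.cast_sub, Int.cast_natCast, sub_mul, Finset.sum_sub_distrib, h]
  push_cast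
  ring

theorem polyToeplitz_lagAtom {d : ℕ} {N : Fin d → ℕ} (fL fH : ℝ) (f : Fin d → ℝ) (i : Fin d)
    (m n : MultiIdx fun j => N j - 1) :
    polyToeplitz (bandPoly fL fH) i (lagAtom N f) m n =
      ((4 * Real.sign (fH - fL) *
        (Real.sin (Real.pi * (fH - f i)) * Real.sin (Real.pi * (f i - fL))) : ℝ) : ℂ) *
        (atom (fun j => N j - 1) f m * (starRingEnd ℂ) (atom (fun j => N j - 1) f n)) := by
  unfold polyToeplitz
  rw [lagAtom_shiftedLag, lagAtom_shiftedLag, lagAtom_shiftedLag, ← bandPoly_value fL fH (f i)]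
  simp only [Int.cast_neg, Int.cast_one, Int.cast_zero, neg_mul, one_mul, zero_mul, neg_zero,
    neg_neg, Complex.exp_zero]
  ring

theorem posSemidef_sum_rankOne {ι κ : Type*} [Finite ι] [Fintype κ] (c : κ → ℝ) (hc : ∀ l, 0 ≤ c l)
    (a : κ → ι → ℂ) (M : Matrix ι ι ℂ)
    (hM : ∀ m n, M m n = ∑ l, (c l : ℂ) * (a l m * (starRingEnd ℂ) (a l n))) :
    M.PosSemidef := by
  have : M = ∑ l, (c l : ℂ) • Matrix.vecMulVec (a l) (star (a l)) := by
    ext m n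
    rw [hM, Matrix.sum_apply]
    rfl
  rw [this]
  refine Matrix.posSemidef_sum _ fun l _ => Matrix.PosSemidef.smul ?_ (by exact_mod_cast hc l)
  exact Matrix.posSemidef_vecMulVec_self_star _

theorem objective_eq {d : ℕ} {N : Fin d → ℕ} (hN : ∀ i, 1 ≤ N i) (B : LagTensor N) (t : ℝ)
    (n : MultiIdx N) : objective B t = ((blockToeplitz B n n).re + t) / 2 := by
  have h : ∀ m, blockToeplitz B m m = blockToeplitz B n n := by
    intro m
    simp [blockToeplitz]
  have hcard : Fintype.card (MultiIdx N) = ∏ i, N i := by simp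
  have hpos : ((∏ i, N i : ℕ) : ℝ) ≠ 0 := by
    exact_mod_cast Finset.prod_ne_zero_iff.2 fun i _ => Nat.one_le_iff_ne_zero.1 (hN i)
  unfold objective Matrix.trace
  simp only [Matrix.diag, h, Finset.sum_const, Finset.card_univ, hcard, nsmul_eq_mul]
  rw [← Complex.ofReal_natCast, Complex.re_ofReal_mul]
  field_simp

/-- A decomposition with frequencies in the bands gives a feasible point whose objective is the sum of
the moduli of the coefficients. -/
theorem exists_feasible_of_decomposition {d : ℕ} {N : Fin d → ℕ} (hN : ∀ i, 1 ≤ N i)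
    {fL fH : Fin d → ℝ} (hfL : ∀ i, fL i ∈ Set.Ico (0 : ℝ) 1)
    (hfH : ∀ i, fH i ∈ Set.Ico (0 : ℝ) 1) {X : Tensor N} {κ : Type*} [Fintype κ]
    (f : κ → Fin d → ℝ) (σ : κ → ℂ) (hf : ∀ l i, f l i ∈ band (fL i) (fH i))
    (hX : X = ∑ l, σ l • atom N (f l)) :
    ∃ (B : LagTensor N) (t : ℝ), Feasible fL fH X B t ∧ objective B t = ∑ l, ‖σ l‖ := by
  -- The phases `u l` of the coefficients are carried by the last coordinate of the bordered vectors.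
  have hu : ∀ l, ∃ u : ℂ, ‖u‖ = 1 ∧ σ l = ‖σ l‖ * u := by
    intro l
    refine ⟨Complex.exp (Complex.arg (σ l) * Complex.I), Complex.norm_exp_ofReal_mul_I _, ?_⟩
    rw [Complex.norm_mul_exp_arg_mul_I]
  choose u hu1 hu2 using hu
  have huu : ∀ l, (starRingEnd ℂ) (u l) * u l = 1 := by
    intro l
    rw [Complex.conj_mul', hu1]
    simp
  have hB : ∀ m n, blockToeplitz (∑ l, (‖σ l‖ : ℂ) • lagAtom N (f l)) m n =
      ∑ l, (‖σ l‖ : ℂ) * (atom N (f l) m * (starRingEnd ℂ) (atom N (f l) n)) := by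
    intro m n
    simp only [← blockToeplitz_lagAtom]
    simp [blockToeplitz]
  have hXm : ∀ m, X m = ∑ l, (‖σ l‖ : ℂ) * (atom N (f l) m * u l) := by
    intro m
    rw [hX]
    simp only [Finset.sum_apply, Pi.smul_apply, smul_eq_mul]
    refine Finset.sum_congr rfl fun l _ => ?_
    rw [hu2 l]
    simp only [norm_mul, Complex.norm_real, norm_norm, hu1]
    push_cast
    ring
  refine ⟨∑ l, (‖σ l‖ : ℂ) • lagAtom N (f l), ∑ l, ‖σ l‖, ⟨?_, ?_⟩, ?_⟩
  · refine posSemidef_sum_rankOne (fun l => ‖σ l‖) (fun l => norm_nonneg _)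
      (fun l => Sum.elim (atom N (f l)) fun _ => (starRingEnd ℂ) (u l)) _ ?_
    rintro (m | m) (n | n)
    · simpa [bordered] using hB m n
    · simpa [bordered] using hXm m
    · simp only [bordered, Matrix.fromBlocks_apply₂₁, Matrix.conjTranspose_apply,
        Matrix.replicateCol_apply, hXm n]
      simp only [← starRingEnd_apply, map_sum, map_mul, Sum.elim_inl, Sum.elim_inr,
        Complex.conj_ofReal]
      exact Finset.sum_congr rfl fun l _ => by ring
    · simp [bordered, huu]
  · intro i
    refine posSemidef_sum_rankOne (fun l => ‖σ l‖ * (4 * Real.sign (fH i - fL i) *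
        (Real.sin (Real.pi * (fH i - f l i)) * Real.sin (Real.pi * (f l i - fL i)))))
      (fun l => mul_nonneg (norm_nonneg _) ?_) (fun l => atom (fun j => N j - 1) (f l)) _ ?_
    · exact (bandPoly_nonneg_iff (hfL i) (hfH i)
        (band_subset (hfL i) (hfH i) (hf l i))).2 (hf l i)
    · intro m n
      simp only [Complex.ofReal_mul (‖σ _‖), mul_assoc (‖σ _‖ : ℂ), ← polyToeplitz_lagAtom]
      simp only [polyToeplitz, Finset.sum_apply, Pi.smul_apply, smul_eq_mul, Finset.mul_sum,
        ← Finset.sum_add_distrib]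
      exact Finset.sum_congr rfl fun l _ => by ring
  · have hn : ∀ l (n : MultiIdx N), atom N (f l) n * (starRingEnd ℂ) (atom N (f l) n) = 1 := by
      intro l n
      rw [atom_eq_exp, conj_exp_I_mul, ← Complex.exp_add]
      simp
    rw [objective_eq hN _ _ fun i => ⟨0, hN i⟩, hB]
    simp [hn]

/-! ### Existence of decompositions -/

theorem exp_two_pi_injOn :
    Set.InjOn (fun f : ℝ => Complex.exp (Complex.I * (2 * Real.pi * f : ℝ))) (Set.Ico 0 1) := by
  intro a ha b hb hab
  obtain ⟨n, hn⟩ := Complex.exp_eq_exp_iff_exists_int.1 hab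
  have h1 : (a : ℂ) = ((b + n : ℝ) : ℂ) := by
    have h2 : (2 * Real.pi * Complex.I : ℂ) ≠ 0 := Complex.two_pi_I_ne_zero
    refine mul_left_cancel₀ h2 ?_
    push_cast at hn ⊢
    linear_combination hn
  have h2 : a = b + n := by exact_mod_cast h1
  have h3 : (n : ℝ) < 1 := by linarith [ha.2, hb.1]
  have h4 : (-1 : ℝ) < n := by linarith [ha.1, hb.2]
  have h5 : n < 1 := by exact_mod_cast h3
  have h6 : -1 < n := by exact_mod_cast h4
  have h7 : n = 0 := by omega
  simpa [h7] using h2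

theorem band_infinite {fL fH : ℝ} (hL : fL ∈ Set.Ico (0 : ℝ) 1) : (band fL fH).Infinite := by
  unfold band
  split_ifs with h
  · exact Set.Icc_infinite h
  · refine (Set.Ico_infinite hL.2).mono fun x hx => ⟨⟨hL.1.trans hx.1, hx.2⟩, fun h2 => ?_⟩
    exact absurd hx.1 (not_le.2 h2.2)

/-- One-dimensional sinusoids at `N` distinct frequencies of the band form an invertible
(Vandermonde) matrix. -/
theorem exists_sinusoid_inverse {fL fH : ℝ} (hL : fL ∈ Set.Ico (0 : ℝ) 1)
    (hH : fH ∈ Set.Ico (0 : ℝ) 1) (N : ℕ) :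
    ∃ (g : Fin N → ℝ) (W : Matrix (Fin N) (Fin N) ℂ), (∀ l, g l ∈ band fL fH) ∧
      ∀ k n, ∑ l, sinusoid (g l) N k * W l n = if k = n then 1 else 0 := by
  let e := (band_infinite (fH := fH) hL).natEmbedding
  let g : Fin N → ℝ := fun l => e l
  let V := Matrix.vandermonde fun l => Complex.exp (Complex.I * (2 * Real.pi * g l : ℝ))
  have hg : ∀ l, g l ∈ band fL fH := fun l => (e l).2
  have hV : IsUnit V.transpose.det := by
    rw [isUnit_iff_ne_zero, Matrix.det_transpose]
    refine Matrix.det_vandermonde_ne_zero_iff.2 fun a b hab => ?_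
    have := exp_two_pi_injOn (band_subset hL hH (hg a)) (band_subset hL hH (hg b)) hab
    exact Fin.ext (e.injective (Subtype.ext this))
  refine ⟨g, V.transpose⁻¹, hg, fun k n => ?_⟩
  have h := congrFun (congrFun (Matrix.mul_nonsing_inv _ hV) k) n
  rw [Matrix.mul_apply, Matrix.one_apply] at h
  rw [← h]
  refine Finset.sum_congr rfl fun l _ => ?_
  congr 1
  simp only [sinusoid, V, Matrix.transpose_apply, Matrix.vandermonde_apply, ← Complex.exp_nat_mul]
  congr 1
  push_cast
  ring

/-- Every tensor is a combination of atoms with frequencies in the bands: on a product grid of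
frequencies the atoms form a Kronecker product of Vandermonde matrices. -/
theorem exists_decomposition {d : ℕ} {N : Fin d → ℕ} {fL fH : Fin d → ℝ}
    (hfL : ∀ i, fL i ∈ Set.Ico (0 : ℝ) 1) (hfH : ∀ i, fH i ∈ Set.Ico (0 : ℝ) 1) (X : Tensor N) :
    ∃ (f : MultiIdx N → Fin d → ℝ) (σ : MultiIdx N → ℂ),
      (∀ l i, f l i ∈ band (fL i) (fH i)) ∧ X = ∑ l, σ l • atom N (f l) := by
  choose g W hg hW using fun i => exists_sinusoid_inverse (hfL i) (hfH i) (N i)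
  refine ⟨fun l i => g i (l i), fun l => ∑ n, (∏ i, W i (l i) (n i)) * X n, fun l i => hg i _, ?_⟩
  have h : ∀ k n : MultiIdx N, ∑ l : MultiIdx N, ∏ i, (sinusoid (g i (l i)) (N i) (k i) *
      W i (l i) (n i)) = if k = n then 1 else 0 := by
    intro k n
    rw [← Fintype.prod_sum fun i l => sinusoid (g i l) (N i) (k i) * W i l (n i)]
    simp only [hW]
    split_ifs with hkn
    · simp [hkn]
    · obtain ⟨i, hi⟩ := Function.ne_iff.1 hkn
      exact Finset.prod_eq_zero (Finset.mem_univ i) (if_neg hi)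
  funext k
  simp only [Finset.sum_apply, Pi.smul_apply, smul_eq_mul, atom, Finset.sum_mul]
  rw [Finset.sum_comm]
  calc X k = ∑ n, (if k = n then 1 else 0) * X n := by simp
    _ = _ := by
      refine Finset.sum_congr rfl fun n _ => ?_
      rw [← h, Finset.sum_mul]
      refine Finset.sum_congr rfl fun l _ => ?_
      rw [Finset.prod_mul_distrib]
      ring

/-! ### Existence of minimizers -/

theorem exists_gram {ι : Type*} [Fintype ι] {M : Matrix ι ι ℂ} (hM : M.PosSemidef) :
    ∃ v : ι → EuclideanSpace ℂ ι, ∀ m n, M m n = inner ℂ (v m) (v n) := by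
  classical
  open scoped MatrixOrder in
  obtain ⟨A, hA⟩ := CStarAlgebra.nonneg_iff_eq_star_mul_self.1 (Matrix.nonneg_iff_posSemidef.2 hM)
  refine ⟨fun n => WithLp.toLp 2 fun k => A k n, fun m n => ?_⟩
  rw [hA, Matrix.mul_apply, PiLp.inner_apply]
  exact Finset.sum_congr rfl fun k _ => by
    simp [Matrix.star_apply, mul_comm]

theorem isClosed_posSemidef {ι : Type*} [Fintype ι] :
    IsClosed {M : Matrix ι ι ℂ | M.PosSemidef} := by
  simp only [Matrix.posSemidef_iff_dotProduct_mulVec, Set.ofPred_and, Set.ofPred_forall]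
  refine IsClosed.inter ?_ (isClosed_iInter fun x => ?_)
  · exact isClosed_eq (by fun_prop) continuous_id
  · exact isClosed_le continuous_const (by fun_prop)

theorem continuous_blockToeplitz {d : ℕ} {N : Fin d → ℕ} :
    Continuous (blockToeplitz : LagTensor N → _) := by
  unfold blockToeplitz
  fun_prop

theorem isClosed_feasible {d : ℕ} {N : Fin d → ℕ} (fL fH : Fin d → ℝ) (X : Tensor N) :
    IsClosed {p : LagTensor N × ℝ | Feasible fL fH X p.1 p.2} := by
  simp only [Feasible, Set.ofPred_and, Set.ofPred_forall]
  refine IsClosed.inter ?_ (isClosed_iInter fun i => ?_)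
  · refine isClosed_posSemidef.preimage
      (f := fun p : LagTensor N × ℝ => bordered (blockToeplitz p.1) X p.2) ?_
    unfold bordered
    refine Continuous.matrix_fromBlocks (continuous_blockToeplitz.comp continuous_fst)
      continuous_const continuous_const ?_
    exact continuous_matrix fun _ _ => by simpa using by fun_prop
  · refine isClosed_posSemidef.preimage
      (f := fun p : LagTensor N × ℝ => polyToeplitz (bandPoly (fL i) (fH i)) i p.1) ?_
    unfold polyToeplitz
    fun_prop

theorem continuous_objective {d : ℕ} {N : Fin d → ℕ} :
    Continuous fun p : LagTensor N × ℝ => objective p.1 p.2 := by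
  have : Continuous fun p : LagTensor N × ℝ => (blockToeplitz p.1).trace :=
    (continuous_blockToeplitz.comp continuous_fst).matrix_trace
  unfold objective
  fun_prop

theorem exists_lag_eq {d : ℕ} {N : Fin d → ℕ} (p : ∀ i, Lag (N i)) :
    ∃ m n : MultiIdx N, ∀ B : LagTensor N, blockToeplitz B m n = B p := by
  have h : ∀ i, ∃ a b : Fin (N i), ((a : ℕ) : ℤ) - ((b : ℕ) : ℤ) = p i := by
    intro i
    obtain ⟨h1, h2⟩ := abs_lt.1 (p i).2
    exact ⟨⟨(p i : ℤ).toNat, by omega⟩, ⟨(-(p i : ℤ)).toNat, by omega⟩, by simp only; omega⟩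
  choose m n hmn using h
  exact ⟨m, n, fun B => congrArg B (funext fun i => Subtype.ext (hmn i))⟩

/-- A feasible point is bounded by its objective value, since the entries of a positive semidefinite
Toeplitz matrix are bounded by its diagonal entry. -/
theorem norm_le_of_feasible {d : ℕ} {N : Fin d → ℕ} (hN : ∀ i, 1 ≤ N i) {fL fH : Fin d → ℝ}
    {X : Tensor N} {B : LagTensor N} {t : ℝ} (h : Feasible fL fH X B t) :
    (∀ p, ‖B p‖ ≤ 2 * objective B t) ∧ |t| ≤ 2 * objective B t := by
  obtain ⟨v, hv⟩ := exists_gram h.1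
  let n₀ : MultiIdx N := fun i => ⟨0, hN i⟩
  have ht : t = ‖v (Sum.inr ())‖ ^ 2 := by
    have := hv (Sum.inr ()) (Sum.inr ())
    rw [inner_self_eq_norm_sq_to_K] at this
    simp only [bordered, Matrix.fromBlocks_apply₂₂, Matrix.of_apply] at this
    exact Complex.ofReal_injective (this.trans (by simp))
  have hB : ∀ m : MultiIdx N, (blockToeplitz B n₀ n₀).re = ‖v (Sum.inl m)‖ ^ 2 := by
    intro m
    have h1 := hv (Sum.inl m) (Sum.inl m)
    rw [inner_self_eq_norm_sq_to_K] at h1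
    have h2 : blockToeplitz B n₀ n₀ = blockToeplitz B m m := by simp [blockToeplitz]
    simp only [bordered, Matrix.fromBlocks_apply₁₁] at h1
    rw [h2, h1]
    simp [← Complex.ofReal_pow]
  rw [objective_eq hN B t n₀]
  constructor
  · intro p
    obtain ⟨m, n, hmn⟩ := exists_lag_eq p
    have h1 : B p = inner ℂ (v (Sum.inl m)) (v (Sum.inl n)) := by
      rw [← hmn B, ← hv]
      rfl
    have h2 := norm_inner_le_norm (𝕜 := ℂ) (v (Sum.inl m)) (v (Sum.inl n))
    rw [h1]
    nlinarith [hB m, hB n, sq_nonneg (‖v (Sum.inl m)‖ - ‖v (Sum.inl n)‖),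
      sq_nonneg ‖v (Sum.inr ())‖]
  · rw [abs_of_nonneg (by rw [ht]; positivity), hB n₀]
    nlinarith [sq_nonneg ‖v (Sum.inl n₀)‖]

theorem exists_isOptimal {d : ℕ} {N : Fin d → ℕ} (hN : ∀ i, 1 ≤ N i) {fL fH : Fin d → ℝ}
    (hfL : ∀ i, fL i ∈ Set.Ico (0 : ℝ) 1) (hfH : ∀ i, fH i ∈ Set.Ico (0 : ℝ) 1) (X : Tensor N) :
    ∃ (B : LagTensor N) (t : ℝ), IsOptimal fL fH X B t := by
  have : ∀ i, Fintype (Lag (N i)) := fun i =>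
    ((Set.finite_Ioo (-(N i : ℤ)) (N i)).subset fun p (hp : |p| < (N i : ℤ)) =>
      abs_lt.1 hp).fintype
  obtain ⟨f, σ, hf, hX⟩ := exists_decomposition hfL hfH X
  obtain ⟨B₀, t₀, h₀, -⟩ := exists_feasible_of_decomposition hN hfL hfH f σ hf hX
  let S := {p : LagTensor N × ℝ | Feasible fL fH X p.1 p.2} ∩
    {p | objective p.1 p.2 ≤ objective B₀ t₀}
  have hclosed : IsClosed S :=
    (isClosed_feasible fL fH X).inter (isClosed_le continuous_objective continuous_const)
  have hS : IsCompact S := by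
    refine Metric.isCompact_of_isClosed_isBounded hclosed ?_
    refine isBounded_iff_forall_norm_le.2 ⟨2 * objective B₀ t₀, fun p hp => ?_⟩
    obtain ⟨h1, h2⟩ := norm_le_of_feasible hN hp.1
    have h3 : objective p.1 p.2 ≤ objective B₀ t₀ := hp.2
    refine max_le ((pi_norm_le_iff_of_nonneg ?_).2 fun q => ?_) ?_
    · linarith [abs_nonneg p.2]
    · linarith [h1 q]
    · rw [Real.norm_eq_abs]
      linarith
  obtain ⟨⟨B, t⟩, hBt, hmin⟩ := hS.exists_isMinOn ⟨(B₀, t₀), h₀, le_refl (objective B₀ t₀)⟩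
    continuous_objective.continuousOn
  refine ⟨B, t, hBt.1, fun B' t' h' => ?_⟩
  rcases le_total (objective B' t') (objective B₀ t₀) with h | h
  · exact hmin (show (B', t') ∈ S from ⟨h', h⟩)
  · exact le_trans hBt.2 h

/-! ### Linear algebra of shifts -/

/-- Two families with the same Gram matrix are related by a linear map that is isometric on the span
of the first. -/
theorem exists_linearMap_of_gram_eq {ι E : Type*} [NormedAddCommGroup E] [InnerProductSpace ℂ E]
    (f g : ι → E) (h : ∀ a b, inner ℂ (f a) (f b) = inner ℂ (g a) (g b)) :
    ∃ L : E →ₗ[ℂ] E, (∀ a, L (f a) = g a) ∧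
      ∀ x ∈ Submodule.span ℂ (Set.range f), ‖L x‖ = ‖x‖ := by
  let F := Finsupp.linearCombination ℂ f
  let G := Finsupp.linearCombination ℂ g
  have hFG : ∀ c, ‖G c‖ = ‖F c‖ := by
    intro c
    have h1 : inner ℂ (G c) (G c) = inner ℂ (F c) (F c) := by
      simp only [F, G, Finsupp.linearCombination_apply, Finsupp.sum, sum_inner, inner_sum,
        inner_smul_left, inner_smul_right, h]
    rw [norm_eq_sqrt_re_inner (𝕜 := ℂ), norm_eq_sqrt_re_inner (𝕜 := ℂ), h1]
  obtain ⟨s, hs⟩ := F.rangeRestrict.exists_rightInverse_of_surjective F.range_rangeRestrict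
  obtain ⟨L, hL⟩ := LinearMap.exists_extend (G ∘ₗ s)
  have hLF : ∀ c, L (F c) = G c := by
    intro c
    have h1 : L (F c) = G (s (F.rangeRestrict c)) := LinearMap.congr_fun hL (F.rangeRestrict c)
    have h2 : F (s (F.rangeRestrict c)) = F c :=
      congrArg Subtype.val (LinearMap.congr_fun hs (F.rangeRestrict c))
    rw [h1, ← sub_eq_zero, ← map_sub, ← norm_eq_zero, hFG, map_sub, h2, sub_self, norm_zero]
  refine ⟨L, fun a => ?_, fun x hx => ?_⟩
  · simpa [F, G] using hLF (Finsupp.single a 1)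
  · rw [← Finsupp.range_linearCombination] at hx
    obtain ⟨c, rfl⟩ := hx
    rw [hLF, hFG]

/-- If the rank is smaller than the side length `M i`, then the vectors with maximal `i`-th index are
redundant: by the Cayley–Hamilton theorem, `L ^ r` is a combination of lower powers of the shift
`L`. -/
theorem span_box_shrink {ι E : Type*} [DecidableEq ι] [AddCommGroup E] [Module ℂ E]
    [FiniteDimensional ℂ E] (v : (ι → ℕ) → E) (M : ι → ℕ) (i : ι)
    (hr : Module.finrank ℂ E < M i) (L : E →ₗ[ℂ] E)
    (hL : ∀ n : ι → ℕ, (∀ j, n j < M j) → n i + 1 < M i → L (v n) = v (n + Pi.single i 1)) :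
    Submodule.span ℂ (v '' {n | ∀ j, n j < M j}) ≤
      Submodule.span ℂ (v '' {n | (∀ j, n j < M j) ∧ n i + 1 < M i}) := by
  refine Submodule.span_le.2 ?_
  rintro _ ⟨n, hn, rfl⟩
  have hn : ∀ j, n j < M j := hn
  by_cases hni : n i + 1 < M i
  · exact Submodule.subset_span ⟨n, ⟨hn, hni⟩, rfl⟩
  set r := Module.finrank ℂ E with hrdef
  have hni' : n i + 1 = M i := by
    have := hn i
    omega
  let n' : ι → ℕ := Function.update n i (n i - r)
  have hbox : ∀ k, k ≤ r → ∀ j, (n' + Pi.single i k : ι → ℕ) j < M j := by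
    intro k hk j
    by_cases hj : j = i
    · subst hj
      simp only [n', Pi.add_apply, Function.update_self, Pi.single_eq_same]
      omega
    · simpa [n', hj] using hn j
  have hpow : ∀ k, k ≤ r → (L ^ k) (v n') = v (n' + Pi.single i k) := by
    intro k
    induction k with
    | zero => simp
    | succ k ih =>
      intro hk
      rw [pow_succ', Module.End.mul_apply, ih (by omega), hL _ (hbox k (by omega)), add_assoc,
        ← Pi.single_add]
      simp only [n', Pi.add_apply, Function.update_self, Pi.single_eq_same]
      omega
  have htop : n' + Pi.single i r = n := by
    funext j
    by_cases hj : j = i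
    · subst hj
      simp only [n', Pi.add_apply, Function.update_self, Pi.single_eq_same]
      omega
    · simp [n', hj]
  have hCH : v n + ∑ k ∈ Finset.range r, L.charpoly.coeff k • v (n' + Pi.single i k) = 0 := by
    have h1 := LinearMap.congr_fun (LinearMap.aeval_self_charpoly L) (v n')
    rw [L.charpoly_monic.as_sum, LinearMap.charpoly_natDegree, ← hrdef] at h1
    simp only [map_add, map_sum, map_pow, map_mul, Polynomial.aeval_X, Polynomial.aeval_C,
      LinearMap.add_apply, LinearMap.sum_apply, Module.End.mul_apply,
      Module.algebraMap_end_apply, LinearMap.zero_apply] at h1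
    rw [hpow r le_rfl, htop] at h1
    rw [← h1]
    congr 1
    refine Finset.sum_congr rfl fun k hk => ?_
    rw [hpow k (Finset.mem_range.1 hk).le]
  rw [eq_neg_of_add_eq_zero_left hCH]
  refine Submodule.neg_mem _ (Submodule.sum_mem _ fun k hk => Submodule.smul_mem _ _ ?_)
  have hk' := Finset.mem_range.1 hk
  refine Submodule.subset_span ⟨_, ⟨hbox k hk'.le, ?_⟩, rfl⟩
  simp only [n', Pi.add_apply, Function.update_self, Pi.single_eq_same]
  omega

/-- Reducing one direction at a time, the vectors whose indices are all non-maximal already span. -/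
theorem span_smallBox_eq_top {ι E : Type*} [Fintype ι] [DecidableEq ι] [AddCommGroup E]
    [Module ℂ E] [FiniteDimensional ℂ E] (v : (ι → ℕ) → E) (N : ι → ℕ)
    (hr : ∀ i, Module.finrank ℂ E < N i)
    (hspan : Submodule.span ℂ (v '' {n | ∀ j, n j < N j}) = ⊤) (L : ι → E →ₗ[ℂ] E)
    (hL : ∀ i, ∀ n : ι → ℕ, (∀ j, n j < N j) → n i + 1 < N i →
      L i (v n) = v (n + Pi.single i 1)) :
    Submodule.span ℂ (v '' {n | ∀ j, n j + 1 < N j}) = ⊤ := by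
  have key : ∀ S : Finset ι,
      Submodule.span ℂ (v '' {n | ∀ j, n j < if j ∈ S then N j - 1 else N j}) = ⊤ := by
    intro S
    induction S using Finset.induction_on with
    | empty => simpa using hspan
    | insert i S hi ih =>
      have h1 := span_box_shrink v (fun j => if j ∈ S then N j - 1 else N j) i
        (by simpa [hi] using hr i) (L i) (by
          intro n hn hni
          refine hL i n (fun j => ?_) (by simpa [hi] using hni)
          have := hn j
          beta_reduce at this
          split_ifs at this <;> omega)
      rw [ih, top_le_iff] at h1
      rw [eq_top_iff, ← h1]
      refine Submodule.span_mono (Set.image_mono fun n hn j => ?_)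
      have h2 := hn.1 j
      have h3 := hn.2
      simp only [hi, if_false] at h2 h3
      by_cases hj : j = i
      · subst hj
        simp only [Finset.mem_insert_self, if_true]
        omega
      · simpa [hj] using h2
  rw [eq_top_iff, ← key Finset.univ]
  refine Submodule.span_mono (Set.image_mono fun n hn j => ?_)
  have := hn j
  simp only [Finset.mem_univ, if_true] at this
  omega

/-- Commuting isometries of a finite-dimensional complex inner product space have a common
orthonormal eigenbasis: it diagonalizes the symmetric operators `U + U†` and `i (U - U†)`. -/
theorem exists_joint_eigenbasis {ι : Type} {E : Type*} [NormedAddCommGroup E]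
    [InnerProductSpace ℂ E] [FiniteDimensional ℂ E] (U : ι → E →ₗ[ℂ] E)
    (hU : ∀ i x, ‖U i x‖ = ‖x‖) (hc : ∀ i j, Commute (U i) (U j)) :
    ∃ (κ : Type) (_ : Fintype κ) (b : OrthonormalBasis κ ℂ E) (ζ : κ → ι → ℂ),
      ∀ k i, U i (b k) = ζ k i • b k := by
  classical
  have h1 : ∀ i, LinearMap.adjoint (U i) * U i = 1 := by
    intro i
    refine LinearMap.ext fun x => ext_inner_left ℂ fun y => ?_
    rw [Module.End.mul_apply, LinearMap.adjoint_inner_right, Module.End.one_apply]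
    exact (LinearMap.norm_map_iff_inner_map_map (U i)).1 (hU i) y x
  have h2 : ∀ i, U i * LinearMap.adjoint (U i) = 1 := fun i => mul_eq_one_comm.1 (h1 i)
  have hc1 : ∀ i j, Commute (LinearMap.adjoint (U i)) (U j) := by
    intro i j
    calc LinearMap.adjoint (U i) * U j
        = LinearMap.adjoint (U i) * U j * (U i * LinearMap.adjoint (U i)) := by rw [h2, mul_one]
      _ = LinearMap.adjoint (U i) * (U j * U i) * LinearMap.adjoint (U i) := by
        simp only [mul_assoc]
      _ = (LinearMap.adjoint (U i) * U i) * U j * LinearMap.adjoint (U i) := by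
        rw [(hc j i).eq]
        simp only [mul_assoc]
      _ = U j * LinearMap.adjoint (U i) := by rw [h1, one_mul]
  have hc2 : ∀ i j, Commute (LinearMap.adjoint (U i)) (LinearMap.adjoint (U j)) := by
    intro i j
    have := congrArg LinearMap.adjoint (hc j i).eq
    simp only [Module.End.mul_eq_comp, LinearMap.adjoint_comp] at this
    exact this
  let T : ι × Bool → E →ₗ[ℂ] E := fun p =>
    if p.2 then U p.1 + LinearMap.adjoint (U p.1)
    else Complex.I • (U p.1 - LinearMap.adjoint (U p.1))
  have hT : ∀ p, (T p).IsSymmetric := by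
    rintro ⟨i, _ | _⟩
    · intro x y
      simp only [T, Bool.false_eq_true, if_false, LinearMap.smul_apply, LinearMap.sub_apply,
        inner_smul_left, inner_smul_right, inner_sub_left, inner_sub_right,
        LinearMap.adjoint_inner_left, LinearMap.adjoint_inner_right, Complex.conj_I]
      ring
    · intro x y
      simp only [T, if_true, LinearMap.add_apply, inner_add_left, inner_add_right,
        LinearMap.adjoint_inner_left, LinearMap.adjoint_inner_right]
      ring
  have hTc : ∀ p q, Commute (T p) (T q) := by
    rintro ⟨i, _ | _⟩ ⟨j, _ | _⟩ <;>
      simp only [T, Bool.false_eq_true, if_false, if_true]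
    · exact (((hc i j).sub_right (hc1 j i).symm).sub_left
        ((hc1 i j).sub_right (hc2 i j))).smul_left _ |>.smul_right _
    · exact (((hc i j).add_right (hc1 j i).symm).sub_left
        ((hc1 i j).add_right (hc2 i j))).smul_left _
    · exact (((hc i j).sub_right (hc1 j i).symm).add_left
        ((hc1 i j).sub_right (hc2 i j))).smul_right _
    · exact ((hc i j).add_right (hc1 j i).symm).add_left ((hc1 i j).add_right (hc2 i j))
  have hint := LinearMap.IsSymmetric.directSum_isInternal_of_pairwise_commute hT
    fun p q _ => hTc p q
  have hfam := LinearMap.IsSymmetric.orthogonalFamily_iInf_eigenspaces hT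
  let b₀ := hint.collectedBasis fun χ => (stdOrthonormalBasis ℂ _).toBasis
  have hb₀ : Orthonormal ℂ b₀ := DirectSum.IsInternal.collectedBasis_orthonormal hfam hint
    fun χ => by simp [OrthonormalBasis.orthonormal]
  have : Fintype (Σ χ : ι × Bool → ℂ, Fin (Module.finrank ℂ
      (⨅ j, Module.End.eigenspace (T j) (χ j) : Submodule ℂ E))) :=
    FiniteDimensional.fintypeBasisIndex b₀
  -- `U = ((U + U†) - i · i (U - U†)) / 2` gives the eigenvalue of `U`.
  refine ⟨_, this, b₀.toOrthonormalBasis hb₀,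
    fun k i => (k.1 (i, true) - Complex.I * k.1 (i, false)) / 2, fun k i => ?_⟩
  have hmem : b₀ k ∈ (⨅ j, Module.End.eigenspace (T j) (k.1 j) : Submodule ℂ E) :=
    hint.collectedBasis_mem _ k
  have e1 := Module.End.mem_eigenspace_iff.1 ((Submodule.mem_iInf _).1 hmem (i, true))
  have e2 := Module.End.mem_eigenspace_iff.1 ((Submodule.mem_iInf _).1 hmem (i, false))
  simp only [T, if_true, Bool.false_eq_true, if_false, LinearMap.smul_apply, LinearMap.sub_apply,
    LinearMap.add_apply] at e1 e2
  beta_reduce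
  rw [Module.Basis.coe_toOrthonormalBasis, div_eq_inv_mul, mul_smul, sub_smul, mul_smul, ← e1,
    ← e2, smul_smul, Complex.I_mul_I]
  module

/-! ### Low-rank block Toeplitz matrices -/

theorem exists_frequency {ζ : ℂ} (hζ : ‖ζ‖ = 1) :
    ∃ f ∈ Set.Ico (0 : ℝ) 1, ζ = Complex.exp (-(Complex.I * (2 * Real.pi * f : ℝ))) := by
  let x : ℝ := -Complex.arg ζ / (2 * Real.pi)
  refine ⟨Int.fract x, ⟨Int.fract_nonneg x, Int.fract_lt_one x⟩, ?_⟩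
  have h1 : ζ = Complex.exp (Complex.arg ζ * Complex.I) := by
    simpa [hζ] using (Complex.norm_mul_exp_arg_mul_I ζ).symm
  conv_lhs => rw [h1]
  refine Complex.exp_eq_exp_iff_exists_int.2 ⟨-⌊x⌋, ?_⟩
  have h2 : Complex.arg ζ = -(2 * Real.pi * x) := by
    simp only [x]
    field_simp
  rw [h2, Int.fract]
  push_cast
  ring

/-- The shifts `v n ↦ v (n + e_i)` of a spanning family with block Toeplitz Gram matrix of small rank
extend to commuting unitary operators `U i`, and there is an orthonormal basis in which all of them
are diagonal. -/
theorem exists_diagonal_shifts {d : ℕ} {N : Fin d → ℕ} {E : Type*} [NormedAddCommGroup E]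
    [InnerProductSpace ℂ E] [FiniteDimensional ℂ E] (v : (Fin d → ℕ) → E)
    (hr : ∀ i, Module.finrank ℂ E < N i)
    (hspan : Submodule.span ℂ (v '' {n | ∀ j, n j < N j}) = ⊤)
    (hv : ∀ i m n, (∀ j, m j < N j) → m i + 1 < N i → (∀ j, n j < N j) → n i + 1 < N i →
      inner ℂ (v m) (v n) = inner ℂ (v (m + Pi.single i 1)) (v (n + Pi.single i 1))) :
    Submodule.span ℂ (v '' {n | ∀ j, n j + 1 < N j}) = ⊤ ∧
    ∃ (U : Fin d → E →ₗ[ℂ] E) (κ : Type) (_ : Fintype κ) (b : OrthonormalBasis κ ℂ E)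
      (f : κ → Fin d → ℝ), (∀ i x, ‖U i x‖ = ‖x‖) ∧
      (∀ i n, (∀ j, n j < N j) → n i + 1 < N i → U i (v n) = v (n + Pi.single i 1)) ∧
      (∀ k i, f k i ∈ Set.Ico (0 : ℝ) 1) ∧
      ∀ k i, U i (b k) = Complex.exp (-(Complex.I * (2 * Real.pi * f k i : ℝ))) • b k := by
  choose U hU1 hU2 using fun i => exists_linearMap_of_gram_eq
    (fun n : {n : Fin d → ℕ // (∀ j, n j < N j) ∧ n i + 1 < N i} => v n)
    (fun n => v (n.1 + Pi.single i 1)) fun m n => hv i m n m.2.1 m.2.2 n.2.1 n.2.2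
  have hU : ∀ i n, (∀ j, n j < N j) → n i + 1 < N i → U i (v n) = v (n + Pi.single i 1) :=
    fun i n h1 h2 => hU1 i ⟨n, h1, h2⟩
  have hsmall := span_smallBox_eq_top v N hr hspan U hU
  have hnorm : ∀ i x, ‖U i x‖ = ‖x‖ := by
    intro i x
    refine hU2 i x ?_
    have h1 := span_box_shrink v N i (hr i) (U i) (hU i)
    rw [hspan] at h1
    refine Submodule.span_mono ?_ (h1 (Submodule.mem_top (x := x)))
    rintro _ ⟨n, hn, rfl⟩
    exact ⟨⟨n, hn⟩, rfl⟩
  have hcomm : ∀ i j, Commute (U i) (U j) := by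
    intro i j
    rcases eq_or_ne i j with rfl | hij
    · exact Commute.refl _
    refine LinearMap.ext_on hsmall ?_
    rintro _ ⟨n, hn, rfl⟩
    have hn : ∀ j, n j + 1 < N j := hn
    have hbox : ∀ i j, (n + Pi.single i 1 : Fin d → ℕ) j < N j := by
      intro i j
      have := hn j
      by_cases hji : j = i
      · subst hji
        simpa using this
      · simp only [Pi.add_apply, Pi.single_eq_of_ne hji]
        omega
    have hlt : ∀ j, n j < N j := fun j => (Nat.lt_succ_self _).trans (hn j)
    rw [Module.End.mul_apply, Module.End.mul_apply, hU j n hlt (hn j), hU i n hlt (hn i),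
      hU i _ (hbox j) (by simpa [hij] using hn i), hU j _ (hbox i) (by simpa [hij.symm] using hn j),
      add_right_comm]
  obtain ⟨κ, _, b, ζ, hζ⟩ := exists_joint_eigenbasis U hnorm hcomm
  have hζ1 : ∀ k i, ‖ζ k i‖ = 1 := by
    intro k i
    have := hnorm i (b k)
    rwa [hζ, norm_smul, b.orthonormal.1 k, mul_one] at this
  choose f hf1 hf2 using fun k i => exists_frequency (hζ1 k i)
  exact ⟨hsmall, U, κ, _, b, f, hnorm, hU, hf1, fun k i => by rw [hζ, hf2]⟩

/-- Positivity of a matrix of the form `⟨w m, g(U) w n⟩` on a spanning family `w` is positivity of the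
quadratic form `u ↦ ⟨u, g(U) u⟩`. -/
theorem quadraticForm_nonneg {ι E : Type*} [Fintype ι] [NormedAddCommGroup E]
    [InnerProductSpace ℂ E] (w : ι → E) (hw : Submodule.span ℂ (Set.range w) = ⊤)
    (U : E →ₗ[ℂ] E) (a b c : ℂ) {M : Matrix ι ι ℂ} (hM : M.PosSemidef)
    (hMw : ∀ m n, M m n = a * inner ℂ (U (w m)) (w n) + b * inner ℂ (w m) (w n) +
      c * inner ℂ (w m) (U (w n))) (u : E) :
    0 ≤ a * inner ℂ (U u) u + b * inner ℂ u u + c * inner ℂ u (U u) := by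
  obtain ⟨y, hy⟩ := (Submodule.mem_span_range_iff_exists_fun ℂ).1
    (hw.symm ▸ Submodule.mem_top (x := u))
  have h := hM.dotProduct_mulVec_nonneg y
  refine h.trans_eq ?_
  rw [← hy]
  simp only [dotProduct, Matrix.mulVec, hMw, map_sum, map_smul, sum_inner, inner_sum,
    inner_smul_left, inner_smul_right, Pi.star_apply, Finset.mul_sum, ← Finset.sum_add_distrib]
  rw [Finset.sum_comm]
  refine Finset.sum_congr rfl fun n _ => Finset.sum_congr rfl fun m _ => ?_
  rw [← starRingEnd_apply]
  ring

/-- The coordinates of a Gram family of `T(B)` in the joint eigenbasis of the shifts are sinusoids;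
the matrices `T_{g_i}(B)` force the frequencies into the bands. -/
theorem exists_basis_atoms {d : ℕ} {N : Fin d → ℕ} {fL fH : Fin d → ℝ}
    (hfL : ∀ i, fL i ∈ Set.Ico (0 : ℝ) 1) (hfH : ∀ i, fH i ∈ Set.Ico (0 : ℝ) 1)
    {E : Type*} [NormedAddCommGroup E] [InnerProductSpace ℂ E] [FiniteDimensional ℂ E]
    {B : LagTensor N} (v : MultiIdx N → E) (hr : ∀ i, Module.finrank ℂ E < N i)
    (hspan : Submodule.span ℂ (Set.range v) = ⊤)
    (hv : ∀ m n, blockToeplitz B m n = inner ℂ (v m) (v n))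
    (hpos : ∀ i, (polyToeplitz (bandPoly (fL i) (fH i)) i B).PosSemidef) :
    ∃ (κ : Type) (_ : Fintype κ) (b : OrthonormalBasis κ ℂ E) (f : κ → Fin d → ℝ) (c : κ → ℂ),
      (∀ k i, f k i ∈ band (fL i) (fH i)) ∧
      ∀ n k, inner ℂ (v n) (b k) = atom N (f k) n * c k := by
  -- Extension by zero to all of `ℕ^d`, where the shifts `n + e_i` need no bound; only indices inside
  -- the box matter.
  let V : (Fin d → ℕ) → E := fun n => if h : ∀ j, n j < N j then v fun j => ⟨n j, h j⟩ else 0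
  have hV : ∀ n : MultiIdx N, V (fun j => n j) = v n := fun n => dif_pos fun j => (n j).2
  have hB : ∀ m n : Fin d → ℕ, (∀ j, m j < N j) → (∀ j, n j < N j) → ∀ p : ∀ j, Lag (N j),
      (∀ j, (p j : ℤ) = (m j : ℤ) - n j) → B p = inner ℂ (V m) (V n) := by
    intro m n hm hn p hp
    have h1 := hv (fun j => ⟨m j, hm j⟩) (fun j => ⟨n j, hn j⟩)
    rw [← hV, ← hV] at h1
    rw [← h1]
    exact congrArg B (funext fun j => Subtype.ext (hp j))
  have hshift : ∀ (n : Fin d → ℕ) i, (∀ j, n j < N j) → n i + 1 < N i →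
      ∀ j, (n + Pi.single i 1 : Fin d → ℕ) j < N j := by
    intro n i hn hni j
    by_cases hj : j = i
    · subst hj
      simpa using hni
    · simpa [hj] using hn j
  have hspanV : Submodule.span ℂ (V '' {n | ∀ j, n j < N j}) = ⊤ := by
    rw [eq_top_iff, ← hspan]
    refine Submodule.span_mono ?_
    rintro _ ⟨n, rfl⟩
    exact ⟨fun j => n j, fun j => (n j).2, hV n⟩
  have hinv : ∀ i m n, (∀ j, m j < N j) → m i + 1 < N i → (∀ j, n j < N j) → n i + 1 < N i →
      inner ℂ (V m) (V n) = inner ℂ (V (m + Pi.single i 1)) (V (n + Pi.single i 1)) := by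
    intro i m n hm hmi hn hni
    let p : ∀ j, Lag (N j) := fun j => ⟨(m j : ℤ) - n j, abs_sub_lt ⟨m j, hm j⟩ ⟨n j, hn j⟩⟩
    rw [← hB m n hm hn p fun j => rfl,
      ← hB _ _ (hshift m i hm hmi) (hshift n i hn hni) p fun j => by simp [p]]
  obtain ⟨hsmall, U, κ, _, b, f, hnorm, hU, hf, hUb⟩ := exists_diagonal_shifts V hr hspanV hinv
  have hinner : ∀ i x k, inner ℂ (U i x) (b k) =
      Complex.exp (Complex.I * (2 * Real.pi * f k i : ℝ)) * inner ℂ x (b k) := by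
    intro i x k
    have h1 : inner ℂ (U i x) (U i (b k)) = inner ℂ x (b k) :=
      (LinearMap.norm_map_iff_inner_map_map (U i)).1 (hnorm i) x (b k)
    rw [hUb, inner_smul_right] at h1
    rw [← h1, ← mul_assoc, ← Complex.exp_add, add_neg_cancel, Complex.exp_zero, one_mul]
  have hcoef : ∀ k (s : ℕ) (n : Fin d → ℕ), ∑ j, n j = s → (∀ j, n j < N j) →
      inner ℂ (V n) (b k) = Complex.exp (Complex.I * (2 * Real.pi * ∑ j, (n j : ℝ) * f k j : ℝ)) *
        inner ℂ (V 0) (b k) := by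
    intro k s
    induction s with
    | zero =>
      intro n hn _
      have : n = 0 := funext fun j => Finset.sum_eq_zero_iff.1 hn j (Finset.mem_univ j)
      simp [this]
    | succ s ih =>
      intro n hn hbox
      obtain ⟨i, hi⟩ : ∃ i, n i ≠ 0 := by
        by_contra! h
        simp [h] at hn
      obtain ⟨n', rfl⟩ : ∃ n' : Fin d → ℕ, n = n' + Pi.single i 1 := by
        refine ⟨n - Pi.single i 1, (tsub_add_cancel_of_le ?_).symm⟩
        intro j
        by_cases hj : j = i
        · subst hj
          simpa using Nat.one_le_iff_ne_zero.2 hi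
        · simp [hj]
      have hni := hbox i
      simp only [Pi.add_apply, Pi.single_eq_same] at hni
      have hbox' : ∀ j, n' j < N j := fun j =>
        lt_of_le_of_lt (Nat.le_add_right _ _) (hbox j)
      have hs : ∑ j, n' j = s := by
        simpa [Finset.sum_add_distrib] using hn
      rw [← hU i n' hbox' hni, hinner, ih n' hs hbox', ← mul_assoc, ← Complex.exp_add]
      congr 2
      have : ∑ j, (((n' + Pi.single i 1 : Fin d → ℕ) j : ℕ) : ℝ) * f k j =
          ∑ j, (n' j : ℝ) * f k j + f k i := by
        simp [add_mul, Finset.sum_add_distrib, Pi.single_apply]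
      rw [this]
      push_cast
      ring
  refine ⟨κ, _, b, f, fun k => inner ℂ (V 0) (b k), fun k i => ?_, fun n k => ?_⟩
  · refine (bandPoly_nonneg_iff (hfL i) (hfH i) (hf k i)).1 ?_
    have hlt : ∀ m : MultiIdx (fun j => N j - 1), ∀ j, (m j : ℕ) < N j :=
      fun m j => lt_of_lt_of_le (m j).2 (Nat.sub_le _ _)
    have hlt' : ∀ m : MultiIdx (fun j => N j - 1), ∀ j, (m j : ℕ) + 1 < N j :=
      fun m j => Nat.add_lt_of_lt_sub (m j).2
    have hw : Submodule.span ℂ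
        (Set.range fun m : MultiIdx (fun j => N j - 1) => V fun j => m j) = ⊤ := by
      rw [eq_top_iff, ← hsmall]
      refine Submodule.span_mono ?_
      rintro _ ⟨n, hn, rfl⟩
      exact ⟨fun j => ⟨n j, Nat.lt_sub_of_add_lt (hn j)⟩, rfl⟩
    have hq := quadraticForm_nonneg _ hw (U i) ((bandPoly (fL i) (fH i)).coeff (-1))
      ((bandPoly (fL i) (fH i)).coeff 0) ((bandPoly (fL i) (fH i)).coeff 1) (hpos i) (by
        intro m n
        unfold polyToeplitz
        rw [hU i _ (hlt m) (hlt' m i), hU i _ (hlt n) (hlt' n i),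
          hB _ _ (hshift _ i (hlt m) (hlt' m i)) (hlt n) (shiftedLag i m n (-1) (by simp)) ?_,
          hB _ _ (hlt m) (hlt n) (shiftedLag i m n 0 (by simp)) ?_,
          hB _ _ (hlt m) (hshift _ i (hlt n) (hlt' n i)) (shiftedLag i m n 1 (by simp)) ?_]
        all_goals
          intro j
          simp only [shiftedLag, Pi.add_apply, Pi.single_apply]
          split_ifs <;> push_cast <;> ring) (b k)
    have hbb : inner ℂ (b k) (b k) = (1 : ℂ) := by
      rw [inner_self_eq_norm_sq_to_K, b.orthonormal.1 k]
      simp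
    rw [hinner, hUb, inner_smul_right, hbb, mul_one, mul_one, mul_one, bandPoly_value] at hq
    exact_mod_cast hq
  · rw [← hV, hcoef k _ _ rfl fun j => (n j).2, atom_eq_exp]

theorem finrank_span_gram {ι E : Type*} [Fintype ι] [NormedAddCommGroup E]
    [InnerProductSpace ℂ E] (v : ι → E) {M : Matrix ι ι ℂ}
    (hM : ∀ m n, M m n = inner ℂ (v m) (v n)) :
    Module.finrank ℂ (Submodule.span ℂ (Set.range v)) = M.rank := by
  let φ : E →ₗ[ℂ] ι → ℂ := LinearMap.pi fun m => (innerSL ℂ (v m) : E →ₗ[ℂ] ℂ)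
  have hinj : Function.Injective (φ ∘ₗ (Submodule.span ℂ (Set.range v)).subtype) := by
    refine (injective_iff_map_eq_zero _).2 fun x hx => ?_
    have h1 : ∀ y ∈ Submodule.span ℂ (Set.range v), inner ℂ y (x : E) = 0 := by
      intro y hy
      induction hy using Submodule.span_induction with
      | mem y hy =>
        obtain ⟨m, rfl⟩ := hy
        exact congrFun hx m
      | zero => simp
      | add y z _ _ hy hz => rw [inner_add_left, hy, hz, add_zero]
      | smul a y _ hy => rw [inner_smul_left, hy, mul_zero]
    exact Subtype.ext (inner_self_eq_zero.1 (h1 x x.2))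
  rw [← LinearMap.finrank_range_of_inj hinj, LinearMap.range_comp, Submodule.range_subtype,
    Submodule.map_span, ← Set.range_comp, Matrix.rank_eq_finrank_span_cols]
  have hcol : φ ∘ v = M.col := funext fun n => funext fun m => (hM m n).symm
  rw [hcol]

/-! ### Bounding the atomic norm by the objective -/

theorem atomicNorm_le_of_decomposition {d : ℕ} {N : Fin d → ℕ} {fL fH : Fin d → ℝ} {X : Tensor N}
    {κ : Type*} [Fintype κ] (f : κ → Fin d → ℝ) (σ : κ → ℂ)
    (hf : ∀ l i, f l i ∈ band (fL i) (fH i)) (hX : X = ∑ l, σ l • atom N (f l)) :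
    atomicNorm N fL fH X ≤ ((∑ l, ‖σ l‖ : ℝ) : EReal) := by
  let e := (Fintype.equivFin κ).symm
  refine sInf_le ⟨Fintype.card κ, f ∘ e, σ ∘ e, fun l i => hf _ i, ?_, ?_⟩
  · rw [hX]
    exact (e.sum_comp fun l => σ l • atom N (f l)).symm
  · rw [← e.sum_comp fun l => ‖σ l‖]
    rfl

/-- Below the rank threshold, every feasible point bounds the atomic norm from above, optimal or not. -/
theorem atomicNorm_le_objective {d : ℕ} {N : Fin d → ℕ} (hN : ∀ i, 1 ≤ N i) {fL fH : Fin d → ℝ}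
    (hfL : ∀ i, fL i ∈ Set.Ico (0 : ℝ) 1) (hfH : ∀ i, fH i ∈ Set.Ico (0 : ℝ) 1) {X : Tensor N}
    {B : LagTensor N} {t : ℝ} (h : Feasible fL fH X B t)
    (hr : ∀ i, (blockToeplitz B).rank < N i) :
    atomicNorm N fL fH X ≤ (objective B t : EReal) := by
  obtain ⟨v, hv⟩ := exists_gram h.1
  let S := Submodule.span ℂ (Set.range fun n => v (Sum.inl n))
  let vS : MultiIdx N → S := fun n => ⟨v (Sum.inl n), Submodule.subset_span ⟨n, rfl⟩⟩
  have hvS : ∀ m n, blockToeplitz B m n = inner ℂ (vS m) (vS n) :=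
    fun m n => hv (Sum.inl m) (Sum.inl n)
  have hrank : Module.finrank ℂ S = (blockToeplitz B).rank :=
    finrank_span_gram _ fun m n => hv (Sum.inl m) (Sum.inl n)
  have hspan : Submodule.span ℂ (Set.range vS) = ⊤ := (Submodule.span_range_subtype_eq_top_iff S _).2 rfl
  obtain ⟨κ, _, b, f, c, hf, hc⟩ := exists_basis_atoms hfL hfH vS
    (fun i => by rw [hrank]; exact hr i) hspan hvS h.2
  let n₀ : MultiIdx N := fun i => ⟨0, hN i⟩
  -- Projecting the last Gram vector to `S` keeps the inner products with `S` and lowers the norm.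
  let w : S := S.orthogonalProjectionOnto (v (Sum.inr ()))
  have hX : ∀ m, X m = inner ℂ (vS m) w := by
    intro m
    have h1 : X m = inner ℂ (v (Sum.inl m)) (v (Sum.inr ())) := hv (Sum.inl m) (Sum.inr ())
    rw [h1]
    exact (S.inner_orthogonalProjectionOnto_eq_of_mem_left (vS m) _).symm
  have ht : ‖w‖ ^ 2 ≤ t := by
    have h1 := hv (Sum.inr ()) (Sum.inr ())
    rw [inner_self_eq_norm_sq_to_K] at h1
    have h2 : t = ‖v (Sum.inr ())‖ ^ 2 := Complex.ofReal_injective (h1.trans (by simp))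
    rw [h2]
    gcongr
    exact S.norm_orthogonalProjectionOnto_apply_le _
  have hB : (blockToeplitz B n₀ n₀).re = ‖vS n₀‖ ^ 2 := by
    rw [hvS]
    exact inner_self_eq_norm_sq (𝕜 := ℂ) (vS n₀)
  refine (atomicNorm_le_of_decomposition f (fun k => c k * inner ℂ (b k) w) hf ?_).trans ?_
  · funext m
    rw [hX, ← b.sum_inner_mul_inner]
    simp only [hc, Finset.sum_apply, Pi.smul_apply, smul_eq_mul]
    exact Finset.sum_congr rfl fun k _ => by ring
  · -- The inequality of arithmetic and geometric means, term by term, and Parseval's identity.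
    have hck : ∀ k, ‖c k‖ = ‖inner ℂ (vS n₀) (b k)‖ := by
      intro k
      rw [hc, atom_eq_exp]
      simp [n₀]
    have h1 : ∀ k, ‖c k * inner ℂ (b k) w‖ ≤
        (‖inner ℂ (vS n₀) (b k)‖ ^ 2 + ‖inner ℂ (b k) w‖ ^ 2) / 2 := by
      intro k
      rw [norm_mul, hck]
      nlinarith [sq_nonneg (‖inner ℂ (vS n₀) (b k)‖ - ‖inner ℂ (b k) w‖)]
    rw [EReal.coe_le_coe_iff, objective_eq hN B t n₀, hB]
    refine (Finset.sum_le_sum fun k _ => h1 k).trans ?_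
    rw [← Finset.sum_div, Finset.sum_add_distrib, b.sum_sq_norm_inner_left,
      b.sum_sq_norm_inner_right]
    linarith

end FSAtomic

end

theorem proposition2 {d : ℕ} (hd : 2 ≤ d) (N : Fin d → ℕ) (hN : ∀ i, 1 ≤ N i)
    (fL fH : Fin d → ℝ) (hfL : ∀ i, fL i ∈ Set.Ico (0 : ℝ) 1) (hfH : ∀ i, fH i ∈ Set.Ico (0 : ℝ) 1)
    (X : FSAtomic.Tensor N) :
    (∃ (B : FSAtomic.LagTensor N) (t : ℝ), FSAtomic.IsOptimal fL fH X B t) ∧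
    ∀ (B : FSAtomic.LagTensor N) (t : ℝ), FSAtomic.IsOptimal fL fH X B t →
      (FSAtomic.objective B t : EReal) ≤ FSAtomic.atomicNorm N fL fH X ∧
      ((∀ i, (FSAtomic.blockToeplitz B).rank < N i) →
        FSAtomic.atomicNorm N fL fH X = (FSAtomic.objective B t : EReal)) := by
  refine ⟨FSAtomic.exists_isOptimal hN hfL hfH X, fun B t h => ?_⟩
  have hle : (FSAtomic.objective B t : EReal) ≤ FSAtomic.atomicNorm N fL fH X := by
    refine le_sInf ?_
    rintro _ ⟨r, f, σ, hf, hX, rfl⟩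
    obtain ⟨B', t', h', ho⟩ := FSAtomic.exists_feasible_of_decomposition hN hfL hfH f σ hf hX
    rw [← ho]
    exact EReal.coe_le_coe_iff.2 (h.2 B' t' h')
  exact ⟨hle, fun hr => le_antisymm (FSAtomic.atomicNorm_le_objective hN hfL hfH h.1 hr) hle⟩
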